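/- A hypergraph $\mathcal H$ consists of a finite vertex set $V(\mathcal H)$ and a set $E(\mathcal H)$ of subsets of $V(\mathcal H)$, called edges; it is $k$-uniform if every edge has exactly $k$ vertices. Let $a,b\in\mathbb Z_{\ge 0}\cup\{\ast\}$. In the $(a,b)$-game on $\mathcal H$, Maker has $a$ tokens and Breaker has $b$ tokens, where $\ast$ stands for an unlimited supply. Starting from the empty board and with Maker moving first, the players alternate; on their turn, a player either passes, or places one of their unused tokens on an unoccupied vertex, or moves one of their tokens already on the board to an unoccupied vertex. Maker wins if she fills an edge, i.e. at some moment all vertices of some edge carry Maker tokens (if $\varnothing \in E(\mathcal H)$ she wins before the game starts). Breaker wins if he prevents this indefinitely, or if the same state (positions of all tokens and player to move) occurs twice. The $(\ast,\ast)$-game is the classical Maker-Breaker game. Let $\theta(\mathcal H)$ be the minimum $a$ such that Maker has a winning strategy in the $(a,\ast)$-game on $\mathcal H$, and let $\tau(\mathcal H)$ be the minimum $t$ such that Maker has a strategy in the $(\ast,\ast)$-game on $\mathcal H$ that guarantees that she fills an edge after having played at most $t$ moves (each is $\infty$ if no such number exists). **Proposition.** For all integers $k\ge 4$ and $n\ge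 2k+1$, there exists a $k$-uniform hypergraph $\mathcal H$ on $n$ vertices such that $$\theta(\mathcal H)=k\qquad\text{and}\qquad \tau(\mathcal H)=\left\lceil \frac n2\right\rceil .$$ Moreover, this maximizes the gap between $\theta$ and $\tau$: every $k$-uniform hypergraph $\mathcal H'$ on $n$ vertices on which Maker wins the $(\ast,\ast)$-game satisfies $k\le\theta(\mathcal H')\le\tau(\mathcal H')\le\left\lceil \frac n2\right\rceil$, and hence $\tau(\mathcal H')-\theta(\mathcal H')\le\tau(\mathcal H)-\theta(\mathcal H)$. -/

import Mathlib

namespace Hypergraph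

variable {α : Type*}

/-- Every edge of `H` has exactly `k` vertices. -/
def IsUniform (H : Hypergraph α) (k : ℕ) : Prop :=
  ∀ e ∈ H.edgeSet, e.encard = k

/-- The vertex set `M` contains all vertices of some edge of `H`. -/
def Filled (H : Hypergraph α) (M : Set α) : Prop :=
  ∃ e ∈ H.edgeSet, e ⊆ M

/-- A state of the token game: the set of vertices carrying Maker's tokens, the set of vertices
carrying Breaker's tokens, and whose turn it is. -/
structure TokenState (α : Type*) where
  makerToMove : Bool
  maker : Set α
  breaker : Set α

/-- A legal move of a player who owns `c` tokens (`c = ⊤`: an unlimited supply). The player's tokens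
are on `X` before the move and on `X'` after it, while the opponent's tokens are on `Y`. The player
either passes, or puts a new token on an unoccupied vertex `v`, or moves one of the tokens that are
on the board, from a vertex `u`, to an unoccupied vertex `v`. -/
def IsTokenMove (H : Hypergraph α) (c : ℕ∞) (X Y X' : Set α) : Prop :=
  X' = X ∨
  ∃ v ∈ H.vertexSet \ (X ∪ Y),
    (X' = insert v X ∧ X'.encard ≤ c) ∨ ∃ u ∈ X, X' = insert v (X \ {u})

/-- In the game where Maker has `a` tokens and Breaker has `b` tokens, Maker to move with her tokens
on `M` and Breaker's on `B`, Maker has a strategy to fill an edge with at most `t` further moves of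
hers, whatever Breaker does. The set `past` consists of the states that have occurred so far
(including the current one); Breaker wins as soon as a state occurs for the second time. -/
def MakerForces (H : Hypergraph α) (a b : ℕ∞) :
    ℕ → Set (TokenState α) → Set α → Set α → Prop
  | 0, _, M, _ => H.Filled M
  | t + 1, past, M, B =>
      H.Filled M ∨
      ∃ M', H.IsTokenMove a M B M' ∧
        (H.Filled M' ∨
          (⟨false, M', B⟩ ∉ past ∧
            ∀ B', H.IsTokenMove b B M' B' →
              ⟨true, M', B'⟩ ∉ past ∧
              MakerForces H a b t (past ∪ {⟨false, M', B⟩, ⟨true, M', B'⟩}) M' B'))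

/-- Maker, moving first on the empty board, has a strategy to win the `(a, b)`-game on `H` in at most
`t` rounds, that is, having played at most `t` moves. -/
def MakerWinsWithin (H : Hypergraph α) (a b : ℕ∞) (t : ℕ) : Prop :=
  H.MakerForces a b t {⟨true, ∅, ∅⟩} ∅ ∅

/-- Maker wins the `(a, b)`-game on the finite hypergraph `H`. (Since there are finitely many states
and none may be repeated, the length of the plays is bounded, so a winning strategy wins within
a bounded number of rounds.) -/
def MakerWins (H : Hypergraph α) (a b : ℕ∞) : Prop :=
  ∃ t : ℕ, H.MakerWinsWithin a b t

/-- `θ(H)`: the minimum number `a` of tokens with which Maker wins against a Breaker with unlimited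
tokens; it is `⊤` if there is no such `a`. -/
noncomputable def theta (H : Hypergraph α) : ℕ∞ :=
  ⨅ (a : ℕ) (_ : H.MakerWins a ⊤), (a : ℕ∞)

/-- `τ(H)`: the minimum number `t` of rounds within which Maker can force a win when both players
have unlimited tokens; it is `⊤` if there is no such `t`. -/
noncomputable def tau (H : Hypergraph α) : ℕ∞ :=
  ⨅ (t : ℕ) (_ : H.MakerWinsWithin ⊤ ⊤ t), (t : ℕ∞)

end Hypergraph

namespace Hypergraph

variable {α : Type*} {H : Hypergraph α}

/-! For the general bounds: an edge needs `k` tokens, a win in `t` rounds places at most `t` tokens,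
and moving tokens or passing never helps against an unlimited Breaker. So a Maker win can be played
by placements only, and the board is full after `⌈n/2⌉` rounds (`tau_le_of_encard_le`).

For equality, take `s + 1 = ⌈n/2⌉` and `pairChain`, with pairs `x_j = 2j`, `y_j = 2j + 1` and final
vertex `z = 2s`. Maker plays `x_0, x_1, …`, recycling her oldest token once all `k` are placed. Each
`x_j` forces the answer `y_j`, and `x_{s-1}` threatens both `y_{s-1}` and `z`; hence `θ = k`
(`makerForces_pairChain`).

Breaker answers `x_i` by `y_i`. At the first deviation he takes `x_i`, which kills all edges except
those far ahead; these contain three further `x`'s since `k ≥ 4`, enough room for a pairing that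
avoids Maker's stray vertex (`pairingBlocked_pairChain`). So Maker cannot win within `s` moves. -/

lemma Filled.mono {M M' : Set α} (h : H.Filled M) (hM : M ⊆ M') : H.Filled M' :=
  let ⟨e, he, heM⟩ := h
  ⟨e, he, heM.trans hM⟩

lemma Filled.le_encard {k : ℕ} (hH : H.IsUniform k) {M : Set α} (h : H.Filled M) :
    (k : ℕ∞) ≤ M.encard :=
  let ⟨e, he, heM⟩ := h
  hH e he ▸ Set.encard_le_encard heM

lemma MakerForces.succ {a b : ℕ∞} {t : ℕ} {past : Set (TokenState α)} {M B : Set α}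
    (h : H.MakerForces a b t past M B) : H.MakerForces a b (t + 1) past M B := by
  induction t generalizing past M B with
  | zero => exact Or.inl h
  | succ t ih =>
    rcases h with h | ⟨M', hM', h⟩
    · exact Or.inl h
    · refine Or.inr ⟨M', hM', h.imp_right fun h ↦ ⟨h.1, fun B' hB' ↦ ?_⟩⟩
      exact ⟨(h.2 B' hB').1, ih (h.2 B' hB').2⟩

lemma MakerForces.mono {a b : ℕ∞} {t t' : ℕ} (htt : t ≤ t') {past : Set (TokenState α)}
    {M B : Set α} (h : H.MakerForces a b t past M B) : H.MakerForces a b t' past M B := by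
  induction htt with
  | refl => exact h
  | step _ ih => exact ih.succ

lemma IsTokenMove.subset_insert {c : ℕ∞} {X Y X' : Set α} (h : H.IsTokenMove c X Y X') :
    X' = X ∨ ∃ v ∈ H.vertexSet \ (X ∪ Y), X' ⊆ insert v X ∧ v ∈ X' := by
  rcases h with h | ⟨v, hv, ⟨h, -⟩ | ⟨u, -, h⟩⟩
  · exact Or.inl h
  · exact Or.inr ⟨v, hv, h.subset, h ▸ Set.mem_insert _ _⟩
  · exact Or.inr ⟨v, hv, h ▸ Set.insert_subset_insert Set.sdiff_subset, h ▸ Set.mem_insert _ _⟩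

lemma IsTokenMove.encard_le {c : ℕ∞} {X Y X' : Set α} (h : H.IsTokenMove c X Y X')
    (hX : X.encard ≤ c) : X'.encard ≤ c := by
  rcases h with rfl | ⟨v, hv, ⟨-, h⟩ | ⟨u, hu, rfl⟩⟩
  · exact hX
  · exact h
  · refine (Set.encard_insert_le _ _).trans ?_
    rwa [Set.encard_sdiff_singleton_add_one hu]

lemma IsTokenMove.encard_le_succ {c : ℕ∞} {X Y X' : Set α} (h : H.IsTokenMove c X Y X') :
    X'.encard ≤ X.encard + 1 := by
  rcases h.subset_insert with rfl | ⟨v, -, h, -⟩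
  · exact le_self_add
  · exact (Set.encard_le_encard h).trans (Set.encard_insert_le _ _)

lemma IsTokenMove.mono {c c' : ℕ∞} {X Y X' : Set α} (h : H.IsTokenMove c X Y X')
    (hc : X'.encard ≤ c') : H.IsTokenMove c' X Y X' := by
  rcases h with h | ⟨v, hv, ⟨h, -⟩ | h⟩
  · exact Or.inl h
  · exact Or.inr ⟨v, hv, Or.inl ⟨h, hc⟩⟩
  · exact Or.inr ⟨v, hv, Or.inr h⟩

lemma MakerForces.tokens_mono {a a' b : ℕ∞} {t : ℕ} {past : Set (TokenState α)} {M B : Set α}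
    (h : H.MakerForces a b t past M B) (ha : M.encard + t ≤ a') :
    H.MakerForces a' b t past M B := by
  induction t generalizing past M B with
  | zero => exact h
  | succ t ih =>
    rcases h with h | ⟨M', hM', h⟩
    · exact Or.inl h
    · have hcard : M'.encard + t ≤ a' := by
        refine le_trans ?_ ha
        rw [Nat.cast_succ, add_comm (t : ℕ∞), ← add_assoc]
        gcongr
        exact hM'.encard_le_succ
      refine Or.inr ⟨M', hM'.mono (le_self_add.trans hcard), h.imp_right fun h ↦ ⟨h.1, ?_⟩⟩
      exact fun B' hB' ↦ ⟨(h.2 B' hB').1, ih (h.2 B' hB').2 hcard⟩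

lemma MakerForces.tokens_top {a b : ℕ∞} {t : ℕ} {past : Set (TokenState α)} {M B : Set α}
    (h : H.MakerForces a b t past M B) : H.MakerForces ⊤ b t past M B :=
  h.tokens_mono le_top

/-- Let Breaker pass throughout: the winning play never uses more than `a` tokens. -/
lemma MakerForces.exists_filled {a b : ℕ∞} {t : ℕ} {past : Set (TokenState α)} {M B : Set α}
    (h : H.MakerForces a b t past M B) (hM : M.encard ≤ a) :
    ∃ M', M'.encard ≤ a ∧ H.Filled M' := by
  induction t generalizing past M B with
  | zero => exact ⟨M, hM, h⟩
  | succ t ih =>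
    rcases h with h | ⟨M', hM', h | h⟩
    · exact ⟨M, hM, h⟩
    · exact ⟨M', hM'.encard_le hM, h⟩
    · exact ih (h.2 B (Or.inl rfl)).2 (hM'.encard_le hM)

lemma le_theta {k : ℕ} (hH : H.IsUniform k) : (k : ℕ∞) ≤ H.theta := by
  refine le_iInf₂ fun a ⟨t, ht⟩ ↦ ?_
  obtain ⟨M, hM, hf⟩ := MakerForces.exists_filled ht (by simp)
  exact (hf.le_encard hH).trans hM

lemma theta_le_tau : H.theta ≤ H.tau :=
  le_iInf₂ fun t ht ↦ iInf₂_le t ⟨t, MakerForces.tokens_mono ht (by simp)⟩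

/-- A strategy for Breaker. He treats every vertex that Maker has ever occupied as occupied for
ever; `P t M B` says that he is not worried about the position `(M, B)`, Maker to move with `t`
moves left. -/
lemma not_makerForces_of_strategy {a : ℕ∞} (P : ℕ → Set α → Set α → Prop)
    (hfill : ∀ t M B, P t M B → ¬ H.Filled M)
    (hpass : ∀ t M B, P (t + 1) M B → P t M B)
    (hstep : ∀ t M B, P (t + 1) M B → ∀ v ∈ H.vertexSet \ (M ∪ B),
      P t (insert v M) B ∨
        ∃ w ∈ H.vertexSet \ (insert v M ∪ B), P t (insert v M) (insert w B))
    {t : ℕ} {past : Set (TokenState α)} {M N B : Set α} (hP : P t N B) (hMN : M ⊆ N) :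
    ¬ H.MakerForces a ⊤ t past M B := by
  induction t generalizing past M N B with
  | zero => exact fun h ↦ hfill _ _ _ hP (Filled.mono h hMN)
  | succ t ih =>
    rintro (h | ⟨M', hM', h⟩)
    · exact hfill _ _ _ hP (h.mono hMN)
    have key : ∃ N', M' ⊆ N' ∧ ∃ B', H.IsTokenMove ⊤ B M' B' ∧ P t N' B' := by
      have pass : ∀ X, H.IsTokenMove ⊤ B X B := fun X ↦ Or.inl rfl
      rcases hM'.subset_insert with rfl | ⟨v, hv, hsub, -⟩
      · exact ⟨N, hMN, B, pass _, hpass _ _ _ hP⟩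
      have hsub' : M' ⊆ insert v N := hsub.trans (Set.insert_subset_insert hMN)
      by_cases hvN : v ∈ N
      · exact ⟨N, by rwa [Set.insert_eq_of_mem hvN] at hsub', B, pass _, hpass _ _ _ hP⟩
      rcases hstep _ _ _ hP v ⟨hv.1, by grind⟩ with hP' | ⟨w, hw, hP'⟩
      · exact ⟨_, hsub', B, pass _, hP'⟩
      · exact ⟨_, hsub', _, Or.inr ⟨w, ⟨hw.1, by grind⟩, Or.inl ⟨rfl, le_top⟩⟩, hP'⟩
    obtain ⟨N', hN', B', hB', hP'⟩ := key
    rcases h with h | h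
    · exact hfill _ _ _ hP' (h.mono hN')
    · exact ih hP' hN' (h.2 B' hB').2

/-! ### Reduction to placements, and the bound `τ ≤ ⌈n/2⌉` -/

/-- Maker wins the positional game, in which tokens are neither moved nor moves passed, within `t`
moves of hers. -/
def PlaceWin (H : Hypergraph α) : ℕ → Set α → Set α → Prop
  | 0, M, _ => H.Filled M
  | t + 1, M, B =>
      H.Filled M ∨
      ∃ v ∈ H.vertexSet \ (M ∪ B), H.Filled (insert v M) ∨
        ((H.vertexSet \ (insert v M ∪ B)).Nonempty ∧
          ∀ w ∈ H.vertexSet \ (insert v M ∪ B), PlaceWin H t (insert v M) (insert w B))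

lemma PlaceWin.of_filled {t : ℕ} {M B : Set α} (h : H.Filled M) : H.PlaceWin t M B := by
  cases t with
  | zero => exact h
  | succ t => exact Or.inl h

/-- Maker imagines a Breaker who never lifts a token and never passes; `C` is his imagined position.
Her own set grows with each move, so no state recurs. -/
lemma PlaceWin.makerForces {b : ℕ∞} {t : ℕ} {past : Set (TokenState α)} {M B C : Set α}
    (h : H.PlaceWin t M C) (hBC : B ⊆ C) (hpast : ∀ s ∈ past, s.maker ⊆ M) :
    H.MakerForces ⊤ b t past M B := by
  induction t generalizing past M B C with
  | zero => exact h
  | succ t ih =>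
    rcases h with h | ⟨v, hv, h⟩
    · exact Or.inl h
    have hnew : ∀ (p : Bool) (X : Set α), (⟨p, insert v M, X⟩ : TokenState α) ∉ past :=
      fun p X hs ↦ hv.2 (Or.inl (hpast _ hs (Set.mem_insert _ _)))
    refine Or.inr ⟨insert v M, Or.inr ⟨v, ⟨hv.1, by grind⟩, Or.inl ⟨rfl, le_top⟩⟩, ?_⟩
    refine h.imp_right fun ⟨⟨w₀, hw₀⟩, h⟩ ↦ ⟨hnew _ _, fun B' hB' ↦ ⟨hnew _ _, ?_⟩⟩
    have : ∃ w ∈ H.vertexSet \ (insert v M ∪ C), B' ⊆ insert w C := by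
      rcases hB'.subset_insert with rfl | ⟨w, hw, hsub, -⟩
      -- When Breaker occupies nothing new, an arbitrary free vertex `w₀` is credited to him.
      · exact ⟨w₀, hw₀, hBC.trans (Set.subset_insert _ _)⟩
      by_cases hwC : w ∈ C
      · refine ⟨w₀, hw₀, hsub.trans ?_⟩
        exact Set.insert_subset (Or.inr hwC) (hBC.trans (Set.subset_insert _ _))
      · exact ⟨w, ⟨hw.1, by grind⟩, hsub.trans (Set.insert_subset_insert hBC)⟩
    obtain ⟨w, hw, hsub⟩ := this
    refine ih (h w hw) hsub fun s hs ↦ ?_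
    rcases hs with hs | rfl | rfl
    · exact (hpast s hs).trans (Set.subset_insert _ _)
    · exact subset_rfl
    · exact subset_rfl

/-- Each full round of placements uses two vertices, so `c` rounds exhaust the board; surviving
them, Breaker survives for any number `t` of moves. -/
lemma not_makerForces_of_not_placeWin {a : ℕ∞} {t c : ℕ} {past : Set (TokenState α)} {M B : Set α}
    (hc : (H.vertexSet \ (M ∪ B)).encard ≤ 2 * c) (h : ¬ H.PlaceWin c M B) :
    ¬ H.MakerForces a ⊤ t past M B := by
  refine not_makerForces_of_strategy
    (fun _ M B ↦ ∃ c : ℕ, (H.vertexSet \ (M ∪ B)).encard ≤ 2 * c ∧ ¬ H.PlaceWin c M B)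
    ?_ ?_ ?_ ⟨c, hc, h⟩ subset_rfl
  · exact fun t M B ⟨c, _, h⟩ hf ↦ h (.of_filled hf)
  · exact fun t M B h ↦ h
  · rintro - M B ⟨c, hc, h⟩ v hv
    obtain _ | c := c
    · simp only [Nat.cast_zero, mul_zero, nonpos_iff_eq_zero, Set.encard_eq_zero] at hc
      simp [hc] at hv
    simp only [PlaceWin, not_or, not_exists, not_and] at h
    obtain ⟨hf, h⟩ := h.2 v hv
    rcases (H.vertexSet \ (insert v M ∪ B)).eq_empty_or_nonempty with he | hne
    -- Maker took the last free vertex: with zero rounds left it suffices that no edge is filled.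
    · exact Or.inl ⟨0, by simp [he], hf⟩
    · have := h hne
      push Not at this
      obtain ⟨w, hw, h⟩ := this
      refine Or.inr ⟨w, hw, c, ?_, h⟩
      have heq : H.vertexSet \ (M ∪ B) =
          insert v (insert w (H.vertexSet \ (insert v M ∪ insert w B))) := by
        ext u; grind
      rw [heq, Set.encard_insert_of_notMem (by grind), Set.encard_insert_of_notMem (by grind),
        Nat.cast_succ, mul_add, add_assoc, mul_one, one_add_one_eq_two] at hc
      exact (ENat.add_le_add_iff_right (by simp)).1 hc

lemma tau_le_of_encard_le {c : ℕ} (hc : H.vertexSet.encard ≤ 2 * c) (h : H.MakerWins ⊤ ⊤) :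
    H.tau ≤ c := by
  obtain ⟨t, ht⟩ := h
  refine iInf₂_le c (PlaceWin.makerForces (C := ∅) ?_ subset_rfl ?_)
  · by_contra hn
    exact not_makerForces_of_not_placeWin (by simpa using hc) hn ht
  · rintro s rfl
    exact subset_rfl

/-! ### Pairing strategies -/

/-- `PairingBlocked M B`: every edge either contains a vertex of Breaker, or contains one of several
pairwise disjoint pairs (those of the relation `R`) of unoccupied vertices. -/
def PairingBlocked (H : Hypergraph α) (M B : Set α) : Prop :=
  ∃ R : α → α → Prop, (∀ u w, R u w → R w u) ∧ (∀ u w w', R u w → R u w' → w = w') ∧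
    (∀ u, ¬ R u u) ∧
    ∀ e ∈ H.edgeSet, (∃ u ∈ e, u ∈ B \ M) ∨
      ∃ u w, R u w ∧ u ∈ e ∧ w ∈ e ∧ u ∉ M ∪ B ∧ w ∉ M ∪ B

lemma PairingBlocked.not_filled {M B : Set α} (h : H.PairingBlocked M B) : ¬ H.Filled M := by
  obtain ⟨R, -, -, -, h⟩ := h
  rintro ⟨e, he, heM⟩
  rcases h e he with ⟨u, hu, huB⟩ | ⟨u, w, -, hu, -, hu', -⟩
  · exact huB.2 (heM hu)
  · exact hu' (Or.inl (heM hu))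

lemma PairingBlocked.step {M B : Set α} (h : H.PairingBlocked M B) {v : α}
    (hv : v ∈ H.vertexSet \ (M ∪ B)) :
    H.PairingBlocked (insert v M) B ∨
      ∃ w ∈ H.vertexSet \ (insert v M ∪ B), H.PairingBlocked (insert v M) (insert w B) := by
  obtain ⟨R, hsymm, hfun, hirr, h⟩ := h
  by_cases hw : ∃ w ∈ H.vertexSet \ (insert v M ∪ B), R v w
  · obtain ⟨w, hw, hR⟩ := hw
    refine Or.inr ⟨w, hw, R, hsymm, hfun, hirr, fun e he ↦ ?_⟩
    rcases h e he with ⟨u, hu, huB⟩ | ⟨u, u', huu, hu, hu', hf, hf'⟩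
    · exact Or.inl ⟨u, hu, by grind⟩
    by_cases hwe : w ∈ e
    · exact Or.inl ⟨w, hwe, by grind⟩
    · have h1 : u ≠ v := fun h ↦ hwe (hfun v w u' hR (h ▸ huu) ▸ hu')
      have h2 : u' ≠ v := fun h ↦ hwe (hfun v w u hR (h ▸ hsymm _ _ huu) ▸ hu)
      have h3 : u ≠ w := fun h ↦ hwe (h ▸ hu)
      have h4 : u' ≠ w := fun h ↦ hwe (h ▸ hu')
      exact Or.inr ⟨u, u', huu, hu, hu', by grind, by grind⟩
  · refine Or.inl ⟨R, hsymm, hfun, hirr, fun e he ↦ ?_⟩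
    rcases h e he with ⟨u, hu, huB⟩ | ⟨u, u', huu, hu, hu', hf, hf'⟩
    · exact Or.inl ⟨u, hu, by grind⟩
    have hne : u ≠ u' := fun h ↦ hirr u (h ▸ huu)
    have huV := H.subset_vertexSet_of_mem_edgeSet' he hu
    have huV' := H.subset_vertexSet_of_mem_edgeSet' he hu'
    have h1 : u ≠ v := fun h ↦ hw ⟨u', by grind, h ▸ huu⟩
    have h2 : u' ≠ v := fun h ↦ hw ⟨u, by grind, h ▸ hsymm _ _ huu⟩
    exact Or.inr ⟨u, u', huu, hu, hu', by grind, by grind⟩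

/-! ### The extremal hypergraph, and Breaker's defence for `s` rounds -/

/-- The vertices `2 * j` and `2 * j + 1`, for `j < s`, are the two halves of the `j`-th pair, and
`2 * s` is a final vertex; further vertices are isolated. The edges are the `k`-sets which, for some
`j`, contain the first halves of the `k - 1` last pairs up to the `j`-th (of all these pairs if there
are fewer), and also the second half of the `j`-th pair or, if this pair is the last one,
the final vertex. -/
def pairChain (k s n : ℕ) : Hypergraph (Fin n) where
  vertexSet := Set.univ
  edgeSet := {e | e.encard = k ∧ ∃ j < s,
    (∀ u : Fin n, ∀ i ≤ j, j + 1 < i + k → u.val = 2 * i → u ∈ e) ∧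
    ∃ u ∈ e, u.val = 2 * j + 1 ∨ (j + 1 = s ∧ u.val = 2 * s)}
  subset_vertexSet_of_mem_edgeSet' := fun _ _ ↦ Set.subset_univ _

lemma isUniform_pairChain (k s n : ℕ) : (pairChain k s n).IsUniform k :=
  fun _ he ↦ he.1

/-- First halves of the pairs from the `a`-th up to, but not including, the `b`-th. -/
def firstHalves (n a b : ℕ) : Set (Fin n) :=
  {u | ∃ j, a ≤ j ∧ j < b ∧ u.val = 2 * j}

/-- Second halves of the first `b` pairs. -/
def secondHalves (n b : ℕ) : Set (Fin n) :=
  {u | ∃ j < b, u.val = 2 * j + 1}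

/-- The pairs that Breaker uses once he owns the first half of the `i`-th pair: the second half of
the `j`-th pair, or the final vertex for `j = s`, is paired with the first half of the pair `j - 2`
or `j - 1`, depending on `j < T`; the index `E` is an exception. -/
def blockingPair (s i T E p q : ℕ) : Prop :=
  (∃ j, i + 3 ≤ j ∧ j ≤ s ∧ j ≠ E ∧ (j < s ∧ q = 2 * j + 1 ∨ j = s ∧ q = 2 * s) ∧
    (j < T ∧ p + 4 = 2 * j ∨ T ≤ j ∧ p + 2 = 2 * j)) ∨
  (E ≤ s ∧ p + 4 = 2 * E ∧ q + 2 = 2 * E)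

lemma blockingPair_left_unique {s i T E p q q' : ℕ} (hE : E ≤ s → T = E + 1 ∧ i + 3 ≤ E)
    (h : blockingPair s i T E p q) (h' : blockingPair s i T E p q') : q = q' := by
  rcases h with ⟨j, h⟩ | h <;> rcases h' with ⟨j', h'⟩ | h' <;> omega

lemma blockingPair_right_unique {s i T E p p' q : ℕ}
    (h : blockingPair s i T E p q) (h' : blockingPair s i T E p' q) : p = p' := by
  rcases h with ⟨j, h⟩ | h <;> rcases h' with ⟨j', h'⟩ | h' <;> omega

lemma blockingPair_not_comp {s i T E p q r : ℕ} (hE : E ≤ s → T = E + 1 ∧ i + 3 ≤ E)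
    (h : blockingPair s i T E p q) (h' : blockingPair s i T E q r) : False := by
  rcases h with ⟨j, h⟩ | h <;> rcases h' with ⟨j', h'⟩ | h' <;> omega

/-- Switching from `x_{j-2}` to `x_{j-1}` at `T` leaves `x_{T-2}` unpaired, so `v = x_l` is avoided
by `T = l + 2`. If `v` is the end vertex of index `E`, that index gives up its pair, and both
`x_{E-2}` and `x_{E-1}` become available to pair with each other. The value `E = s + 1` means no
exception. -/
lemma exists_blockingPair (s i v : ℕ) : ∃ T E, (E ≤ s → T = E + 1 ∧ i + 3 ≤ E) ∧
    ∀ p q, blockingPair s i T E p q → p ≠ v ∧ q ≠ v := by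
  have key : ∀ T E, ((∀ j, i + 3 ≤ j → j ≤ s → j ≠ E →
      ¬ (j < s ∧ v = 2 * j + 1 ∨ j = s ∧ v = 2 * s) ∧
      ¬ (j < T ∧ v + 4 = 2 * j ∨ T ≤ j ∧ v + 2 = 2 * j)) ∧
      (E ≤ s → v + 4 ≠ 2 * E ∧ v + 2 ≠ 2 * E)) →
      ∀ p q, blockingPair s i T E p q → p ≠ v ∧ q ≠ v := by
    rintro T E ⟨h1, h2⟩ p q (⟨j, hj⟩ | h)
    · have := h1 j hj.1 hj.2.1 hj.2.2.1
      omega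
    · have := h2 h.1
      omega
  by_cases hz : v = 2 * s
  · by_cases hi : i + 3 ≤ s
    · exact ⟨s + 1, s, by omega, key _ _ ⟨by omega, by omega⟩⟩
    · exact ⟨0, s + 1, by omega, key _ _ ⟨by omega, by omega⟩⟩
  obtain ⟨l, hl | hl⟩ := v.even_or_odd'
  · exact ⟨l + 2, s + 1, by omega, key _ _ ⟨by omega, by omega⟩⟩
  · by_cases hls : i + 3 ≤ l ∧ l < s
    · exact ⟨l + 1, l, by omega, key _ _ ⟨by omega, by omega⟩⟩
    · exact ⟨0, s + 1, by omega, key _ _ ⟨by omega, by omega⟩⟩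

lemma pairingBlocked_pairChain {k s n i : ℕ} (hk : 4 ≤ k) (hs : 2 * s < n) (hi : i < s) {v : Fin n}
    (hv : v ∉ firstHalves n 0 i ∪ secondHalves n i) (hvi : v.val ≠ 2 * i) :
    (pairChain k s n).PairingBlocked (insert v (firstHalves n 0 i))
      (insert ⟨2 * i, by omega⟩ (secondHalves n i)) := by
  obtain ⟨T, E, hE, hTE⟩ := exists_blockingPair s i v.val
  have free : ∀ u : Fin n, u.val ≠ v.val → (2 * i < u.val) →
      u ∉ insert v (firstHalves n 0 i) ∪ insert ⟨2 * i, by omega⟩ (secondHalves n i) := by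
    rintro u huv hu ((rfl | ⟨j, _, hj, hju⟩) | (rfl | ⟨j, hj, hju⟩))
    · exact huv rfl
    · omega
    · simp at hu
    · omega
  refine ⟨fun u w ↦ blockingPair s i T E u.val w.val ∨ blockingPair s i T E w.val u.val,
    fun u w h ↦ h.symm, ?_, ?_, ?_⟩
  · rintro u w w' (h | h) (h' | h')
    · exact Fin.ext (blockingPair_left_unique hE h h')
    · exact (blockingPair_not_comp hE h' h).elim
    · exact (blockingPair_not_comp hE h h').elim
    · exact Fin.ext (blockingPair_right_unique h h')
  · rintro u (h | h)
    · exact blockingPair_not_comp hE h h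
    · exact blockingPair_not_comp hE h h
  · rintro e ⟨-, j, hj, hwin, y, hye, hy⟩
    -- Edges with `j < i` are hit by `y_j`, those with `i ≤ j < i + k - 1` by `x_i`; the rest have
    -- `j ≥ i + 3`.
    by_cases hji : j < i
    · refine Or.inl ⟨y, hye, Or.inr ⟨j, hji, by omega⟩, ?_⟩
      rintro (rfl | ⟨j', _, _, hj'⟩)
      · exact hv (Or.inr ⟨j, hji, by omega⟩)
      · omega
    by_cases hcut : j + 1 < i + k
    · refine Or.inl ⟨⟨2 * i, by omega⟩, hwin _ i (by omega) hcut rfl, Or.inl rfl, ?_⟩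
      rintro (h | ⟨j', _, hj', h⟩)
      · exact hvi (by rw [← h])
      · simp at h; omega
    have pair : ∀ p q : ℕ, (hp : p < n) → (hq : q < n) → blockingPair s i T E p q →
        2 * i < p → 2 * i < q → ⟨p, hp⟩ ∈ e → ⟨q, hq⟩ ∈ e →
        ∃ u w : Fin n, (blockingPair s i T E u.val w.val ∨ blockingPair s i T E w.val u.val) ∧
          u ∈ e ∧ w ∈ e ∧
          u ∉ insert v (firstHalves n 0 i) ∪ insert ⟨2 * i, by omega⟩ (secondHalves n i) ∧
          w ∉ insert v (firstHalves n 0 i) ∪ insert ⟨2 * i, by omega⟩ (secondHalves n i) :=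
      fun p q hp hq h hip hiq hpe hqe ↦ ⟨⟨p, hp⟩, ⟨q, hq⟩, Or.inl h, hpe, hqe,
        free _ (hTE p q h).1 hip, free _ (hTE p q h).2 hiq⟩
    have hx : ∀ l, j ≤ l + 2 → l ≤ j → (h : 2 * l < n) → (⟨2 * l, h⟩ : Fin n) ∈ e :=
      fun l hl hl' h ↦ hwin _ l hl' (by omega) rfl
    -- `J` is the index of the end vertex, with `z` counted as `y_s`. In both cases `x_{J-2}` and
    -- `x_{J-1}` lie in the edge.
    obtain ⟨J, hJ, hJs, hyJ⟩ : ∃ J, (J = j ∨ J = j + 1) ∧ J ≤ s ∧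
        (J < s ∧ y.val = 2 * J + 1 ∨ J = s ∧ y.val = 2 * s) := by
      rcases hy with hy | ⟨hjs, hy⟩
      · exact ⟨j, by omega, by omega, by omega⟩
      · exact ⟨j + 1, by omega, by omega, by omega⟩
    right
    by_cases hJE : J = E
    · exact pair (2 * (J - 2)) (2 * (J - 1)) (by omega) (by omega) (Or.inr (by omega)) (by omega)
        (by omega) (hx _ (by omega) (by omega) _) (hx _ (by omega) (by omega) _)
    · by_cases hJT : J < T
      · exact pair (2 * (J - 2)) y (by omega) y.2 (Or.inl ⟨J, by omega⟩) (by omega) (by omega)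
          (hx _ (by omega) (by omega) _) hye
      · exact pair (2 * (J - 1)) y (by omega) y.2 (Or.inl ⟨J, by omega⟩) (by omega) (by omega)
          (hx _ (by omega) (by omega) _) hye

lemma not_makerWinsWithin_pairChain {k s n t : ℕ} (hk : 4 ≤ k) (hs : 2 * s < n) (ht : t ≤ s)
    (a : ℕ∞) : ¬ (pairChain k s n).MakerWinsWithin a ⊤ t := by
  refine not_makerForces_of_strategy
    -- Either Maker has followed the chain, with too few moves left to go past its end, or a pairing
    -- is in force.
    (fun t M B ↦ (∃ i, i + t ≤ s ∧ M = firstHalves n 0 i ∧ B = secondHalves n i) ∨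
      (pairChain k s n).PairingBlocked M B)
    ?_ ?_ ?_ (Or.inl ⟨0, by omega, rfl, ?_⟩) (Set.empty_subset _)
  · rintro t M B (⟨i, hi, rfl, rfl⟩ | h)
    · rintro ⟨e, ⟨-, j, hj, -, y, hye, hy⟩, he⟩
      obtain ⟨l, _, hl, hl'⟩ := he hye
      omega
    · exact h.not_filled
  · rintro t M B (⟨i, hi, h⟩ | h)
    · exact Or.inl ⟨i, by omega, h⟩
    · exact Or.inr h
  · rintro t M B (⟨i, hi, rfl, rfl⟩ | h) v hv
    · by_cases hvi : v.val = 2 * i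
      · refine Or.inr ⟨⟨2 * i + 1, by omega⟩, ⟨Set.mem_univ _, ?_⟩,
          Or.inl ⟨i + 1, by omega, ?_, ?_⟩⟩
        · rintro ((h | ⟨j, _, hj, h⟩) | ⟨j, hj, h⟩)
          · rw [← h] at hvi; simp at hvi
          · simp at h; omega
          · simp at h; omega
        · ext u
          simp only [firstHalves, Set.mem_insert_iff, Set.mem_ofPred_eq, Fin.ext_iff]
          constructor
          · rintro (h | ⟨j, h⟩)
            · exact ⟨i, by omega⟩
            · exact ⟨j, by omega⟩
          · rintro ⟨j, h⟩
            by_cases hji : j = i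
            · left; omega
            · exact Or.inr ⟨j, by omega⟩
        · ext u
          simp only [secondHalves, Set.mem_insert_iff, Set.mem_ofPred_eq, Fin.ext_iff]
          constructor
          · rintro (h | ⟨j, h⟩)
            · exact ⟨i, by omega⟩
            · exact ⟨j, by omega⟩
          · rintro ⟨j, h⟩
            by_cases hji : j = i
            · left; omega
            · exact Or.inr ⟨j, by omega⟩
      · refine Or.inr ⟨⟨2 * i, by omega⟩, ⟨Set.mem_univ _, ?_⟩,
          Or.inr (pairingBlocked_pairChain hk hs (by omega) hv.2 hvi)⟩
        rintro ((h | ⟨j, _, hj, h⟩) | ⟨j, hj, h⟩)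
        · exact hvi (by rw [← h])
        · simp at h; omega
        · simp at h; omega
    · exact (h.step hv).imp Or.inr fun ⟨w, hw, h⟩ ↦ ⟨w, hw, Or.inr h⟩
  · ext u
    simp [secondHalves]

/-! ### Maker's win with `k` tokens -/

/-- If every `k`-set containing `N` is an edge, then Maker wins with her remaining tokens as long as
the board is large enough. -/
lemma makerForces_of_forall_superset {k n : ℕ} {b : ℕ∞} (hV : n ≤ H.vertexSet.encard)
    (hn : 2 * k ≤ n) {N₀ : Set α}
    (hN₀ : ∀ e ⊆ H.vertexSet, N₀ ⊆ e → e.encard = k → e ∈ H.edgeSet) {d : ℕ}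
    {past : Set (TokenState α)} {N B : Set α} (hN : N₀ ⊆ N) (hNV : N ⊆ H.vertexSet)
    (hNk : N.encard + d = k) (hB : B.encard ≤ N.encard) (hpast : ∀ s ∈ past, s.maker ⊆ N) :
    H.MakerForces k b d past N B := by
  induction d generalizing past N B with
  | zero => exact ⟨N, hN₀ N hNV hN (by simpa using hNk), subset_rfl⟩
  | succ d ih =>
    have hlt : (N ∪ B).encard < H.vertexSet.encard := by
      obtain ⟨c, hc⟩ := ENat.ne_top_iff_exists.1 (fun h ↦ by simp [h] at hNk : N.encard ≠ ⊤)
      rw [← hc] at hNk hB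
      have hcd : c + (d + 1) = k := by exact_mod_cast hNk
      calc (N ∪ B).encard ≤ N.encard + B.encard := Set.encard_union_le _ _
        _ ≤ (c : ℕ∞) + c := by rw [← hc]; gcongr
        _ < n := by exact_mod_cast (by omega : c + c < n)
        _ ≤ _ := hV
    obtain ⟨v, hvV, hv⟩ : ∃ v ∈ H.vertexSet, v ∉ N ∪ B := by
      by_contra! h
      exact hlt.not_ge (Set.encard_le_encard h)
    have hvN : v ∉ N := fun h ↦ hv (Or.inl h)
    have hcard : (insert v N).encard + d = k := by
      rw [Set.encard_insert_of_notMem hvN, ← hNk, Nat.cast_succ, add_assoc, add_comm 1 (d : ℕ∞)]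
    have hnew : ∀ (p : Bool) (X : Set α), (⟨p, insert v N, X⟩ : TokenState α) ∉ past :=
      fun p X hs ↦ hvN (hpast _ hs (Set.mem_insert _ _))
    refine Or.inr ⟨insert v N, Or.inr ⟨v, ⟨hvV, hv⟩, Or.inl ⟨rfl, hcard ▸ le_self_add⟩⟩,
      Or.inr ⟨hnew _ _, fun B' hB' ↦ ⟨hnew _ _, ?_⟩⟩⟩
    refine ih (hN.trans (Set.subset_insert _ _)) (Set.insert_subset hvV hNV) hcard ?_ ?_
    · rw [Set.encard_insert_of_notMem hvN]
      exact hB'.encard_le_succ.trans (by gcongr)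
    · rintro s (hs | rfl | rfl)
      · exact (hpast s hs).trans (Set.subset_insert _ _)
      · exact subset_rfl
      · exact subset_rfl

lemma encard_firstHalves {n a b : ℕ} (hb : 2 * b ≤ n + 1) :
    (firstHalves n a b).encard = (b - a : ℕ) := by
  have h : Fin.val '' firstHalves n a b = (fun j ↦ 2 * j) '' (Finset.Ico a b : Set ℕ) := by
    ext u
    constructor
    · rintro ⟨w, ⟨j, h1, h2, h3⟩, rfl⟩
      exact ⟨j, by simp [h1, h2], h3.symm⟩
    · rintro ⟨j, hj, rfl⟩
      have hj := Finset.mem_Ico.1 (Finset.mem_coe.1 hj)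
      exact ⟨⟨2 * j, by omega⟩, ⟨j, hj.1, hj.2, rfl⟩, rfl⟩
  rw [← Fin.val_injective.encard_image, h,
    (mul_right_injective₀ (two_ne_zero' ℕ)).encard_image, Set.encard_coe_eq_coe_finsetCard,
    Nat.card_Ico]

lemma encard_secondHalves_le (n b : ℕ) : (secondHalves n b).encard ≤ b := by
  have h : Fin.val '' secondHalves n b ⊆ (fun j ↦ 2 * j + 1) '' (Finset.range b : Set ℕ) := by
    rintro u ⟨w, ⟨j, hj, h⟩, rfl⟩
    exact ⟨j, by simpa using hj, h.symm⟩
  rw [← Fin.val_injective.encard_image]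
  refine (Set.encard_le_encard h).trans ((Set.encard_image_le _ _).trans ?_)
  rw [Set.encard_coe_eq_coe_finsetCard, Finset.card_range]

/-- An edge needs only the last `k - 1` first halves, so the oldest of the `k` tokens is spare and
moves to `w`. -/
lemma makerForces_pairChain_of_threat {k s n i : ℕ} (hs : 2 * s < n) (hi : i < s) (hk : 1 ≤ k)
    (hki : k ≤ i + 1) {b : ℕ∞} {t : ℕ} {past : Set (TokenState (Fin n))} {B : Set (Fin n)}
    {w : Fin n} (hw : w.val = 2 * i + 1 ∨ (i + 1 = s ∧ w.val = 2 * s)) (hwB : w ∉ B) :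
    (pairChain k s n).MakerForces k b (t + 1) past (firstHalves n (i + 1 - k) (i + 1)) B := by
  have hwM : w ∉ firstHalves n (i + 1 - k) (i + 1) := by
    rintro ⟨j, h1, h2, h3⟩
    omega
  have hu : (⟨2 * (i + 1 - k), by omega⟩ : Fin n) ∈ firstHalves n (i + 1 - k) (i + 1) :=
    ⟨_, le_rfl, by omega, rfl⟩
  refine Or.inr ⟨_, Or.inr ⟨w, ⟨Set.mem_univ _, by simp [hwM, hwB]⟩, Or.inr ⟨_, hu, rfl⟩⟩,
    Or.inl ⟨_, ⟨?_, i, hi, ?_, w, Set.mem_insert _ _, hw⟩, subset_rfl⟩⟩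
  · rw [Set.encard_exchange hwM hu, encard_firstHalves (by omega)]
    congr 1
    omega
  · intro u j hj hjk huj
    refine Or.inr ⟨⟨j, by omega, by omega, huj⟩, fun h ↦ ?_⟩
    rw [Set.mem_singleton_iff, Fin.ext_iff] at h
    simp only at h
    omega

lemma isTokenMove_firstHalves {k s n i : ℕ} (hs : 2 * s < n) (hi : i < s) (hk : 1 ≤ k)
    {B : Set (Fin n)} (hB : B ⊆ secondHalves n i) :
    (pairChain k s n).IsTokenMove k (firstHalves n (i - k) i) B
      (firstHalves n (i + 1 - k) (i + 1)) := by
  refine Or.inr ⟨⟨2 * i, by omega⟩, ⟨Set.mem_univ _, ?_⟩, ?_⟩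
  · rintro (⟨j, _, hj, h⟩ | h)
    · simp at h; omega
    · obtain ⟨j, hj, h⟩ := hB h
      simp at h; omega
  by_cases hik : i < k
  · refine Or.inl ⟨?_, ?_⟩
    · ext u
      simp only [firstHalves, Set.mem_insert_iff, Set.mem_ofPred_eq, Fin.ext_iff]
      constructor
      · rintro ⟨j, h⟩
        by_cases hji : j = i
        · left; omega
        · exact Or.inr ⟨j, by omega⟩
      · rintro (h | ⟨j, h⟩)
        · exact ⟨i, by omega⟩
        · exact ⟨j, by omega⟩
    · rw [encard_firstHalves (by omega)]
      exact_mod_cast (by omega : i + 1 - (i + 1 - k) ≤ k)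
  · refine Or.inr ⟨⟨2 * (i - k), by omega⟩, ⟨i - k, le_rfl, by omega, rfl⟩, ?_⟩
    ext u
    simp only [firstHalves, Set.mem_insert_iff, Set.mem_sdiff, Set.mem_singleton_iff,
      Set.mem_ofPred_eq, Fin.ext_iff]
    constructor
    · rintro ⟨j, h⟩
      by_cases hji : j = i
      · left; omega
      · exact Or.inr ⟨⟨j, by omega⟩, by omega⟩
    · rintro (h | ⟨⟨j, h⟩, h'⟩)
      · exact ⟨i, by omega⟩
      · exact ⟨j, by omega⟩

/-- Late in the chain `y_i` completes an edge at once. Early on, it makes every `k`-superset of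
Maker's set an edge, and any free vertices then do. -/
lemma makerForces_pairChain_of_unanswered {k s n i t : ℕ} (hs : 2 * s < n) (hks : k ≤ s)
    (hi : i < s) (hk : 1 ≤ k) (ht : k ≤ t) {b : ℕ∞} {past : Set (TokenState (Fin n))}
    {B : Set (Fin n)} (hB : B.encard ≤ i + 1) {y : Fin n} (hy : y.val = 2 * i + 1) (hyB : y ∉ B)
    (hpast : ∀ s ∈ past, s.maker ⊆ firstHalves n 0 (i + 1)) :
    (pairChain k s n).MakerForces k b t past (firstHalves n (i + 1 - k) (i + 1)) B := by
  obtain ⟨t, rfl⟩ := Nat.exists_eq_add_of_le' (hk.trans ht)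
  by_cases hki : k ≤ i + 1
  · exact makerForces_pairChain_of_threat hs hi hk hki (Or.inl hy) hyB
  rw [show i + 1 - k = 0 by omega]
  have hyM : y ∉ firstHalves n 0 (i + 1) := by
    rintro ⟨j, h1, h2, h3⟩
    omega
  have hcard : (insert y (firstHalves n 0 (i + 1))).encard = (i + 2 : ℕ) := by
    rw [Set.encard_insert_of_notMem hyM, encard_firstHalves (by omega)]
    norm_cast
  have hnew : ∀ (p : Bool) (X : Set (Fin n)),
      (⟨p, insert y (firstHalves n 0 (i + 1)), X⟩ : TokenState (Fin n)) ∉ past :=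
    fun p X hs ↦ hyM (hpast _ hs (Set.mem_insert _ _))
  refine Or.inr ⟨_, Or.inr ⟨y, ⟨Set.mem_univ _, by simp [hyM, hyB]⟩, Or.inl ⟨rfl, ?_⟩⟩,
    Or.inr ⟨hnew _ _, fun B' hB' ↦ ⟨hnew _ _, ?_⟩⟩⟩
  · rw [hcard]
    exact_mod_cast (by omega : i + 2 ≤ k)
  refine MakerForces.mono (t := k - (i + 2)) (by omega) ?_
  refine makerForces_of_forall_superset (n := n) (by simp [pairChain]) (by omega)
    (N₀ := insert y (firstHalves n 0 (i + 1))) ?_ subset_rfl (Set.subset_univ _) ?_ ?_ ?_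
  · intro e _ he hek
    exact ⟨hek, i, hi, fun u j hj _ hu ↦ he (Or.inr ⟨j, by omega, by omega, hu⟩),
      y, he (Set.mem_insert _ _), Or.inl hy⟩
  · rw [hcard]
    exact_mod_cast (by omega : i + 2 + (k - (i + 2)) = k)
  · rw [hcard]
    refine hB'.encard_le_succ.trans ((add_le_add_left hB 1).trans ?_)
    norm_cast
  · rintro s (hs | rfl | rfl)
    · exact (hpast s hs).trans (Set.subset_insert _ _)
    · exact subset_rfl
    · exact subset_rfl

lemma subset_secondHalves_of_answer {k s n i : ℕ} {b : ℕ∞} {M B B' : Set (Fin n)}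
    (hB : B ⊆ secondHalves n i) (hB' : (pairChain k s n).IsTokenMove b B M B') {y : Fin n}
    (hy : y.val = 2 * i + 1) (hyB : y ∈ B') : B' ⊆ secondHalves n (i + 1) := by
  have hB1 : B ⊆ secondHalves n (i + 1) :=
    hB.trans fun u ⟨j, hj, hu⟩ ↦ ⟨j, hj.trans (Nat.lt_succ_self i), hu⟩
  rcases hB'.subset_insert with rfl | ⟨v, -, hsub, -⟩
  · exact hB1
  · rcases hsub hyB with rfl | hyB
    · exact hsub.trans (Set.insert_subset ⟨i, Nat.lt_succ_self i, hy⟩ hB1)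
    · obtain ⟨j, hj, h⟩ := hB hyB
      omega

lemma makerForces_pairChain {k s n i d : ℕ} (hs : 2 * s < n) (hks : k ≤ s) (hk : 1 ≤ k)
    (hd : i + (d + 1) = s) {b : ℕ∞} {past : Set (TokenState (Fin n))} {B : Set (Fin n)}
    (hB : B ⊆ secondHalves n i) (hpast : ∀ s ∈ past, s.maker ⊆ firstHalves n 0 i) :
    (pairChain k s n).MakerForces k b (d + k + 1) past (firstHalves n (i - k) i) B := by
  induction d using Nat.strong_induction_on generalizing i past B with
  | _ d ih =>
  have hnew : ∀ (p : Bool) (X : Set (Fin n)),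
      (⟨p, firstHalves n (i + 1 - k) (i + 1), X⟩ : TokenState (Fin n)) ∉ past := by
    intro p X hs
    have hx : (⟨2 * i, by omega⟩ : Fin n) ∈ firstHalves n (i + 1 - k) (i + 1) :=
      ⟨i, by omega, by omega, rfl⟩
    obtain ⟨j, _, hj, h⟩ := hpast _ hs hx
    simp at h
    omega
  refine Or.inr ⟨_, isTokenMove_firstHalves hs (by omega) hk hB,
    Or.inr ⟨hnew _ _, fun B' hB' ↦ ⟨hnew _ _, ?_⟩⟩⟩
  have hpast' : ∀ s ∈ past ∪ {⟨false, firstHalves n (i + 1 - k) (i + 1), B⟩,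
      ⟨true, firstHalves n (i + 1 - k) (i + 1), B'⟩}, s.maker ⊆ firstHalves n 0 (i + 1) := by
    rintro s (hs | rfl | rfl)
    · exact (hpast s hs).trans fun u ⟨j, hj, hji, hu⟩ ↦ ⟨j, hj, by omega, hu⟩
    · exact fun u ⟨j, hj, hji, hu⟩ ↦ ⟨j, by omega, hji, hu⟩
    · exact fun u ⟨j, hj, hji, hu⟩ ↦ ⟨j, by omega, hji, hu⟩
  by_cases hy : (⟨2 * i + 1, by omega⟩ : Fin n) ∈ B'
  · have hB1 := subset_secondHalves_of_answer hB hB' rfl hy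
    -- At the last pair, Breaker has spent his answer on `y_{s-1}`, so `z` is free.
    obtain _ | d := d
    · have hz : (⟨2 * s, hs⟩ : Fin n) ∉ B' := fun h ↦ by
        obtain ⟨j, hj, h⟩ := hB1 h
        simp at h
        omega
      exact MakerForces.mono (by omega) (makerForces_pairChain_of_threat (t := 0) hs (by omega) hk
        (by omega) (Or.inr ⟨by omega, rfl⟩) hz)
    · exact MakerForces.mono (by omega) (ih d d.lt_succ_self (by omega) hB1 hpast')
  · refine makerForces_pairChain_of_unanswered hs hks (by omega) hk (by omega)
      (hB'.encard_le_succ.trans ?_) rfl hy hpast'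
    gcongr
    exact (Set.encard_le_encard hB).trans (encard_secondHalves_le _ _)

lemma theta_pairChain {k s n : ℕ} (hs : 2 * s < n) (hks : k ≤ s) (hk : 1 ≤ k) :
    (pairChain k s n).theta = k := by
  refine le_antisymm (iInf₂_le k ⟨(s - 1) + k + 1, ?_⟩) (le_theta (isUniform_pairChain k s n))
  have h := makerForces_pairChain (i := 0) (d := s - 1) (b := ⊤) (past := {⟨true, ∅, ∅⟩}) (B := ∅)
    hs hks hk (by omega) (Set.empty_subset _) (by rintro s rfl; exact Set.empty_subset _)
  rwa [show firstHalves n (0 - k) 0 = ∅ by ext; simp [firstHalves]] at h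

lemma makerWins_top_of_theta_ne_top (h : H.theta ≠ ⊤) : H.MakerWins ⊤ ⊤ := by
  by_contra hn
  refine h (iInf₂_eq_top.2 fun a ⟨t, ht⟩ ↦ (hn ⟨t, MakerForces.tokens_top ht⟩).elim)

lemma tau_pairChain {k s n : ℕ} (hs : 2 * s < n) (hn : n ≤ 2 * (s + 1)) (hks : k ≤ s)
    (hk : 4 ≤ k) : (pairChain k s n).tau = (s + 1 : ℕ) := by
  refine le_antisymm (tau_le_of_encard_le ?_ (makerWins_top_of_theta_ne_top ?_)) ?_
  · simp only [pairChain, Set.encard_univ, ENat.card_eq_coe_fintype_card, Fintype.card_fin]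
    exact_mod_cast hn
  · simp [theta_pairChain hs hks (by omega)]
  · refine le_iInf₂ fun t ht ↦ ?_
    by_contra! h
    exact not_makerWinsWithin_pairChain hk hs (Nat.lt_succ_iff.1 (by exact_mod_cast h)) _ ht

end Hypergraph

theorem mainTheorem3 (k n : ℕ) (hk : 4 ≤ k) (hn : 2 * k + 1 ≤ n) :
    ∃ H : Hypergraph (Fin n),
      H.vertexSet = Set.univ ∧
      H.IsUniform k ∧
      H.theta = k ∧
      H.tau = (⌈(n : ℚ) / 2⌉₊ : ℕ) ∧
      ∀ (β : Type*) (H' : Hypergraph β),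
        H'.vertexSet.encard = n → H'.IsUniform k → H'.MakerWins ⊤ ⊤ →
          (k : ℕ∞) ≤ H'.theta ∧
          H'.theta ≤ H'.tau ∧
          H'.tau ≤ (⌈(n : ℚ) / 2⌉₊ : ℕ) ∧
          H'.tau - H'.theta ≤ H.tau - H.theta := by
  -- The largest `s` leaving room for `z`; then `s + 1 = ⌈n/2⌉`, and `n ≥ 2k + 1` gives `k ≤ s`.
  obtain ⟨s, hs, hns⟩ : ∃ s, 2 * s < n ∧ n ≤ 2 * (s + 1) := ⟨(n - 1) / 2, by omega, by omega⟩
  have hceil : ⌈(n : ℚ) / 2⌉₊ = s + 1 := by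
    rw [Nat.ceil_eq_iff s.succ_ne_zero]
    have h1 : (2 * s : ℚ) < n := by exact_mod_cast hs
    have h2 : (n : ℚ) ≤ 2 * (s + 1) := by exact_mod_cast hns
    constructor
    · simp only [Nat.succ_sub_one]
      linarith
    · push_cast
      linarith
  rw [hceil]
  have hθ := Hypergraph.theta_pairChain (k := k) hs (by omega) (by omega)
  have hτ := Hypergraph.tau_pairChain (k := k) hs hns (by omega) hk
  refine ⟨Hypergraph.pairChain k s n, rfl, Hypergraph.isUniform_pairChain k s n, hθ, hτ, ?_⟩
  intro β H' hV hH' hwin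
  have hle : H'.tau ≤ (s + 1 : ℕ) :=
    Hypergraph.tau_le_of_encard_le (by rw [hV]; exact_mod_cast hns) hwin
  refine ⟨Hypergraph.le_theta hH', Hypergraph.theta_le_tau, hle, ?_⟩
  rw [hθ, hτ]
  exact tsub_le_tsub hle (Hypergraph.le_theta hH')
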